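/- **Model.** All algorithms are deterministic and run on a non-uniform word RAM: there is a separate program for every input size $n$ (it may embed advice that depends only on $n$), words and the $O(1)$ registers have $O(\log n)$ bits, in one step the machine reads or writes one memory word or reads one symbol of its read-only input, and then performs word operations (including lookups in a constant table of size $n^{O(1)}$). Space is the number of bits of read-write memory, including working space; the read-only input and the advice are not counted. $\tilde O(g(n))$ means $O(g(n)\log^{a} n)$ for some constant $a$, as $n\to\infty$. **Random access.** Fix $k\ge 0$ and alphabets $\Sigma_m$ with $|\Sigma_m|\ge 2$. An offline ($k$-error) random access data structure preprocesses a reference $R\in\Sigma_m^m$. It then receives read-only access to a text $T\in\Sigma_m^n$ (and to $R$), and constructs a data structure and a support-length $h\in\{0,\dots,n\}$ such that, if $h<n$, the suffix of $T$ of length $h+1$ cannot be factorized into at most $k$ single symbols and at most $k+1$ (possibly empty) substrings of $R$. Afterwards it returns $T[i]$ for queries $i\in\{n-h+1,\dots,n\}$, with access to $R$ but not to $T$. The construction time is counted after preprocessing; query time $Q$ is amortized, i.e. with construction time $C$, the construction followed by any $\ell\ge 0$ queries takes at most $C+\ell Q$ steps. **Function inversion.** A non-uniform function inversion data structure stores,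 for each $f:[N]\to[N]$, a memory content depending on $f$. Given $y\in[N]$ and evaluation access to $f$ in unit time, a query returns some $x$ with $f(x)=y$ or reports that there is none; arbitrary sequences of queries are answered correctly. Its space includes the working space of the queries, its query time is worst-case, and its preprocessing is unrestricted. **Corollary.** Let $\chi,\delta>0$ be constants with $2/5\le\chi<1$. Assume that there is a (possibly non-uniform) offline random access data structure that, for references of length $m$ and texts of length at most $m^{\chi}\log_2 m$, has space complexity $O(m^{\chi})$ bits, amortized query time $\tilde O(m^{\delta})$ and construction time $\tilde O(m^{\chi+\delta})$. If $\delta<3-7\chi$, then there is a non-uniform function inversion data structure, with space $S=S(N)$ bits and query time $T=T(N)$ for functions $[N]\to[N]$, that improves polynomially over the trade-off $S^3T=\tilde O(N^3)$ of Fiat and Naor, in the range $S\ge N^{2/3}$ where that trade-off is non-trivial. Precisely: $S=\tilde O(N^{\chi/(1-\chi)})$, $T=\tilde O(N^{(\chi+\delta)/(1-\chi)})$, $S\ge N^{2/3}$ for all sufficiently large $N$, and $S^3T=O(N^{3-\varepsilon})$ for some $\varepsilon>0$. (Here $S$ and $T$ are upper bounds on the space and the query time.) -/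

import Mathlib

open Filter Asymptotics

/-! ### Asymptotic notation -/

/-- `g = Õ(h)`: up to a polylogarithmic factor, `g` is bounded by a multiple of `h`. -/
def SoftO (g h : ℕ → ℝ) : Prop :=
  ∃ a : ℕ, g =O[atTop] fun n => Real.log n ^ a * h n

/-! ### The non-uniform word RAM

A program is written for one fixed input size. It works on a read-write memory of `s` cells, each
holding a word of `w` bits, and has random access to a read-only input, given as a function
`I → A`. Its control state (a number below `q`) consists of the program counter and the contents of
the constantly many registers. In the definitions of data structures below, `w = O(log size)` and
`q = size ^ O(1)`, so that the control state fits in `O(1)` words.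

In one step the machine reads one memory cell, or writes one memory cell, or reads one symbol of
the read-only input, and then updates its control state. The update may be any function of the
control state and of the value that was read: every word operation is allowed, and so is the lookup
in a constant table of polynomial size, which is the advice that a non-uniform algorithm embeds.
(Conversely such an update is a constant number of table lookups of a non-uniform word RAM.) -/

/-- The memory: `s` cells holding words of `w` bits. -/
abbrev Memory (s w : ℕ) : Type := Fin s → Fin (2 ^ w)

/-- What a machine does in a given control state. The last argument of `read`, `write` and `probe`
gives the next control state, as a function of the value that was read. -/
inductive Instr (s w q : ℕ) (I A O : Type) : Type
  | read (a : Fin s) (next : Fin (2 ^ w) → Fin q)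
  | write (a : Fin s) (v : Fin (2 ^ w)) (next : Fin q)
  | probe (x : I) (next : A → Fin q)
  | halt (o : O)

/-- A program with `s` memory cells of `w` bits and `q` control states, random access to a read-only
input `I → A`, arguments in `X` (loaded into the registers at the start) and results in `O`. -/
structure Program (s w q : ℕ) (I A X O : Type) where
  start : X → Fin q
  code : Fin q → Instr s w q I A O

namespace Program

variable {s w q : ℕ} {I A X O : Type}

/-- `P.Runs inp p μ t o μ'`: with read-only input `inp`, from control state `p` and memory `μ`,
the program halts after exactly `t` steps with result `o` and leaves the memory `μ'`. -/
inductive Runs (P : Program s w q I A X O) (inp : I → A) :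
    Fin q → Memory s w → ℕ → O → Memory s w → Prop
  | halt {p : Fin q} {μ : Memory s w} {o : O} (h : P.code p = .halt o) :
      Runs P inp p μ 0 o μ
  | read {p : Fin q} {μ μ' : Memory s w} {t : ℕ} {o : O} {a : Fin s} {next : Fin (2 ^ w) → Fin q}
      (h : P.code p = .read a next) (r : Runs P inp (next (μ a)) μ t o μ') :
      Runs P inp p μ (t + 1) o μ'
  | write {p : Fin q} {μ μ' : Memory s w} {t : ℕ} {o : O} {a : Fin s} {v : Fin (2 ^ w)}
      {next : Fin q}
      (h : P.code p = .write a v next) (r : Runs P inp next (Function.update μ a v) t o μ') :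
      Runs P inp p μ (t + 1) o μ'
  | probe {p : Fin q} {μ μ' : Memory s w} {t : ℕ} {o : O} {x : I} {next : A → Fin q}
      (h : P.code p = .probe x next) (r : Runs P inp (next (inp x)) μ t o μ') :
      Runs P inp p μ (t + 1) o μ'

/-- `P.Serves inp ok μ xs ts`: starting from memory `μ`, the queries `xs` are served one after the
other, the memory being passed on from each query to the next. They take `ts` steps respectively,
and every query `x` receives an answer `o` with `ok x o`. -/
inductive Serves (P : Program s w q I A X O) (inp : I → A) (ok : X → O → Prop) :
    Memory s w → List X → List ℕ → Prop
  | nil (μ : Memory s w) : Serves P inp ok μ [] []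
  | cons {μ μ' : Memory s w} {x : X} {o : O} {t : ℕ} {xs : List X} {ts : List ℕ}
      (r : P.Runs inp (P.start x) μ t o μ') (h : ok x o) (rest : Serves P inp ok μ' xs ts) :
      Serves P inp ok μ (x :: xs) (t :: ts)

end Program

/-! ### Random access data structures -/

/-- `X` can be factorized into (at most) `k` single symbols and (at most) `k + 1` (possibly empty)
substrings of `R`, in any order. The factors marked `true` are the single symbols. -/
def Factorizable {α : Type} (k : ℕ) (R X : List α) : Prop :=
  ∃ F : List (Bool × List α),
    (F.map Prod.snd).flatten = X ∧
    (∀ p ∈ F, if p.1 = true then p.2.length = 1 else p.2 <:+: R) ∧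
    F.countP (fun p => p.1) ≤ k ∧
    F.countP (fun p => !p.1) ≤ k + 1

/-- The programs of an offline random access data structure for references of length `m` and texts
of length `n` over the alphabet `{0, …, σ - 1}`.

`preprocess` is the memory after preprocessing the reference; neither the time nor the working space
of the preprocessing is restricted, and for fixed `m`, `n` every such map is computable.
`construct` has random access to the reference and to the text; it leaves the data structure in
memory and returns the support-length. `query` has random access to the reference only. -/
structure OfflineRA (m n σ : ℕ) where
  cells : ℕ
  wordBits : ℕ
  states : ℕ
  wordBits_pos : 0 < wordBits
  preprocess : (Fin m → Fin σ) → Memory cells wordBits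
  construct : Program cells wordBits states (Fin m ⊕ Fin n) (Fin σ) Unit (Fin (n + 1))
  query : Program cells wordBits states (Fin m) (Fin σ) (Fin n) (Fin σ)

namespace OfflineRA

variable {m n σ : ℕ}

/-- Space (of the data structure and working space) in bits. -/
def space (D : OfflineRA m n σ) : ℕ := D.cells * D.wordBits

/-- `D` is a correct `k`-error random access data structure with construction time `Tc` and
amortized query time `Tq`: for every reference `R` and text `T`, the construction halts with a
support-length `h` such that the suffix of `T` of length `h + 1` (if there is one) cannot be
factorized, and afterwards every sequence of queries for positions among the last `h` ones is
answered correctly. The construction followed by `ℓ` queries takes at most `Tc + ℓ * Tq` steps. -/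
def Correct (D : OfflineRA m n σ) (k : ℕ) (Tc Tq : ℝ) : Prop :=
  ∀ (R : Fin m → Fin σ) (T : Fin n → Fin σ),
    ∃ (t : ℕ) (h : Fin (n + 1)) (μ : Memory D.cells D.wordBits),
      D.construct.Runs (Sum.elim R T) (D.construct.start ()) (D.preprocess R) t h μ ∧
      ((h : ℕ) < n → ¬ Factorizable k (List.ofFn R) ((List.ofFn T).drop (n - (h + 1)))) ∧
      ∀ is : List (Fin n), (∀ i ∈ is, n ≤ (i : ℕ) + h) →
        ∃ ts : List ℕ, D.query.Serves R (fun i o => o = T i) μ is ts ∧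
          ((t + ts.sum : ℕ) : ℝ) ≤ Tc + is.length * Tq

end OfflineRA

/-- There is a (possibly non-uniform) offline `k`-error random access data structure for references
of length `m` over an alphabet of size `σ m` and texts of length at most `len m`, on a word RAM with
words of `O(log m)` bits, with space `S m` bits, construction time `Tc m` (after preprocessing) and
amortized query time `Tq m`, for all sufficiently large `m`. -/
def HasOfflineRandomAccess (k : ℕ) (σ : ℕ → ℕ) (len S Tc Tq : ℕ → ℝ) : Prop :=
  ∃ c : ℕ, ∀ᶠ m : ℕ in atTop, ∀ n : ℕ, (n : ℝ) ≤ len m →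
    ∃ D : OfflineRA m n (σ m),
      (D.space : ℝ) ≤ S m ∧ 2 ^ D.wordBits ≤ m ^ c ∧ D.states ≤ m ^ c ∧
      D.Correct k (Tc m) (Tq m)

/-! ### Function inversion -/

/-- A function inversion data structure for functions `f : [N] → [N]`. `preprocess f` is the data
structure stored for `f`; `query` has random access to `f`, receives `y`, and returns a preimage of
`y`, or `none` to report that there is none. -/
structure FunctionInverter (N : ℕ) where
  cells : ℕ
  wordBits : ℕ
  states : ℕ
  wordBits_pos : 0 < wordBits
  preprocess : (Fin N → Fin N) → Memory cells wordBits
  query : Program cells wordBits states (Fin N) (Fin N) (Fin N) (Option (Fin N))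

namespace FunctionInverter

variable {N : ℕ}

/-- Space (of the data structure and working space of the queries) in bits. -/
def space (D : FunctionInverter N) : ℕ := D.cells * D.wordBits

/-- `o` is a correct answer to the inversion query `y`. -/
def IsAnswer (f : Fin N → Fin N) (y : Fin N) : Option (Fin N) → Prop
  | some x => f x = y
  | none => ∀ x, f x ≠ y

/-- Every sequence of inversion queries is answered correctly, in worst-case time `T` per query. -/
def Correct (D : FunctionInverter N) (T : ℝ) : Prop :=
  ∀ (f : Fin N → Fin N) (ys : List (Fin N)),
    ∃ ts : List ℕ, D.query.Serves f (IsAnswer f) (D.preprocess f) ys ts ∧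
      ∀ t ∈ ts, (t : ℝ) ≤ T

end FunctionInverter

/-- There is a non-uniform function inversion data structure for functions `[N] → [N]`, on a word
RAM with words of `O(log N)` bits, that is stored and queried in `S N` bits of space and has query
time `T N`, for all sufficiently large `N`. -/
def HasFunctionInversion (S T : ℕ → ℝ) : Prop :=
  ∃ c : ℕ, ∀ᶠ N : ℕ in atTop, ∃ D : FunctionInverter N,
    (D.space : ℝ) ≤ S N ∧ 2 ^ D.wordBits ≤ N ^ c ∧ D.states ≤ N ^ c ∧ D.Correct (T N)

/-- Space `S` and query time `T` improve polynomially over the trade-off `S³ T = Õ(N³)` of Fiat and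
Naor, in the range `S ≥ N ^ (2/3)` in which that trade-off is non-trivial (for smaller `S` it only
gives `T ≥ N`, the time of exhaustive search). -/
def ImprovesFiatNaor (S T : ℕ → ℝ) : Prop :=
  (∀ᶠ N : ℕ in atTop, (N : ℝ) ^ (2 / 3 : ℝ) ≤ S N) ∧
  ∃ ε : ℝ, 0 < ε ∧ (fun N : ℕ => S N ^ 3 * T N) =O[atTop] fun N : ℕ => (N : ℝ) ^ (3 - ε)

/-! Fix a table `ρ` of random code words of length `n`, one for each value, and let block `x` of the
reference be the code word of `f x`. To invert `f` at `y`, run the random access structure on the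
text `ρ y`, evaluating `f` whenever the reference is probed. A probe that lands in a block encoding
`y` reveals a preimage, and the search stops. A support-length below `n` shows that `ρ y` is not a
substring of the reference, so `y` has no preimage. Otherwise all of `ρ y` can be queried; if no
query touched a block of `y`, then `ρ y` would be determined by the memory and by the other code
words, although the memory has far fewer than `n` bits. Incompressible code words exclude this.

The table must not depend on `f`, since storing it would be too expensive. `card_compresses_mul_le`
bounds the compressible tables for fixed `f` and `y`. A union bound over `y` makes a random table
fail for `f` with probability below `1 / N`; hence `N` independent tables all fail with probability
below `N ^ (-N)`, and `exists_incompressible_family` takes a union bound over the `N ^ N` functions.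
The family is advice, and only the index of a good table is stored with `f`.

`Runs.simulate` transfers runs between the machines and, if no hit occurs, shows independence of the
masked symbols; `inverter_runs` then gives correctness and time. With `m` about `N ^ (1 / (1 - χ))`,
blocks have length about `m ^ χ`, a constant factor above the space, so space and time are `m ^ χ`
and `m ^ (χ + δ)` up to logarithms. The exponent of `S³ T` is `(4χ + δ) / (1 - χ)`, which is below 3
exactly when `δ < 3 - 7χ`. -/

/-! ### Simulation of one program by another -/

/-- The instruction of a simulating machine: memory accesses are redirected along `cell`, words are
translated by `enc` and `dec`, control states by `κ`; probes and halting are handled by `onProbe`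
and `onHalt`. -/
def Instr.lift {s w q s' w' q' : ℕ} {I A O I' A' O' : Type} (cell : Fin s → Fin s')
    (enc : Fin (2 ^ w) → Fin (2 ^ w')) (dec : Fin (2 ^ w') → Fin (2 ^ w)) (κ : Fin q → Fin q')
    (onProbe : I → (A → Fin q') → Instr s' w' q' I' A' O')
    (onHalt : O → Instr s' w' q' I' A' O') :
    Instr s w q I A O → Instr s' w' q' I' A' O'
  | .read a next => .read (cell a) fun v => κ (next (dec v))
  | .write a v next => .write (cell a) (enc v) (κ next)
  | .probe x next => onProbe x fun a => κ (next a)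
  | .halt o => onHalt o

namespace Program

/-- A program is deterministic: result and final memory are determined by the initial
configuration. -/
theorem Runs.unique {s w q : ℕ} {I A X O : Type} {P : Program s w q I A X O} {inp : I → A}
    {p : Fin q} {μ μ₁ μ₂ : Memory s w} {t₁ t₂ : ℕ} {o₁ o₂ : O}
    (h₁ : P.Runs inp p μ t₁ o₁ μ₁) (h₂ : P.Runs inp p μ t₂ o₂ μ₂) : o₁ = o₂ ∧ μ₁ = μ₂ := by
  induction h₁ generalizing t₂ with
  | halt h =>
    cases h₂ with
    | halt h' => rw [h] at h'; cases h'; exact ⟨rfl, rfl⟩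
    | read h' => rw [h] at h'; cases h'
    | write h' => rw [h] at h'; cases h'
    | probe h' => rw [h] at h'; cases h'
  | read h _ ih =>
    cases h₂ with
    | halt h' => rw [h] at h'; cases h'
    | read h' r => rw [h] at h'; cases h'; exact ih r
    | write h' => rw [h] at h'; cases h'
    | probe h' => rw [h] at h'; cases h'
  | write h _ ih =>
    cases h₂ with
    | halt h' => rw [h] at h'; cases h'
    | read h' => rw [h] at h'; cases h'
    | write h' r => rw [h] at h'; cases h'; exact ih r
    | probe h' => rw [h] at h'; cases h'
  | probe h _ ih =>
    cases h₂ with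
    | halt h' => rw [h] at h'; cases h'
    | read h' => rw [h] at h'; cases h'
    | write h' => rw [h] at h'; cases h'
    | probe h' r => rw [h] at h'; cases h'; exact ih r

/-- The prescribed answers to a sequence of queries are determined by the memory. -/
theorem Serves.unique {s w q : ℕ} {I A X O : Type} {P : Program s w q I A X O} {inp : I → A}
    {u v : X → O} {μ : Memory s w} {xs : List X} {ts ts' : List ℕ}
    (h₁ : P.Serves inp (fun x o => o = u x) μ xs ts)
    (h₂ : P.Serves inp (fun x o => o = v x) μ xs ts') : ∀ x ∈ xs, u x = v x := by
  induction xs generalizing μ ts ts' with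
  | nil => simp
  | cons x xs ih =>
    cases h₁ with
    | cons r₁ e₁ rest₁ =>
      cases h₂ with
      | cons r₂ e₂ rest₂ =>
        obtain ⟨ho, hμ⟩ := r₁.unique r₂
        subst hμ
        intro z hz
        rcases List.mem_cons.1 hz with rfl | hz
        · rw [← e₁, ← e₂, ho]
        · exact ih rest₁ rest₂ z hz

/-- If every query can be served from every memory in a class `V`, within time `T` and without
leaving `V`, then every sequence of queries can be served. -/
theorem exists_serves {s w q : ℕ} {I A X O : Type} {P : Program s w q I A X O} {inp : I → A}
    {ok : X → O → Prop} {V : Memory s w → Prop} {T : ℝ}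
    (h : ∀ x μ, V μ → ∃ t o μ', P.Runs inp (P.start x) μ t o μ' ∧ ok x o ∧ V μ' ∧ (t : ℝ) ≤ T)
    (xs : List X) : ∀ μ, V μ → ∃ ts, P.Serves inp ok μ xs ts ∧ ∀ t ∈ ts, ((t : ℕ) : ℝ) ≤ T := by
  induction xs with
  | nil => exact fun μ _ => ⟨[], .nil μ, by simp⟩
  | cons x xs ih =>
    intro μ hμ
    obtain ⟨t, o, μ', r, ho, hμ', ht⟩ := h x μ hμ
    obtain ⟨ts, hts, hT⟩ := ih μ' hμ'
    refine ⟨t :: ts, .cons r ho hts, ?_⟩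
    intro u hu
    rcases List.mem_cons.1 hu with rfl | hu
    · exact ht
    · exact hT u hu

section Simulation

variable {s w q s' w' q' : ℕ} {I A X O I' A' X' O' : Type}
  {P : Program s w q I A X O} {P' : Program s' w' q' I' A' X' O'} {inp : I → A} {inp' : I' → A'}
  {cell : Fin s → Fin s'} {enc : Fin (2 ^ w) → Fin (2 ^ w')} {dec : Fin (2 ^ w') → Fin (2 ^ w)}
  {κ : Fin q → Fin q'} {onProbe : I → (A → Fin q') → Instr s' w' q' I' A' O'}
  {onHalt : O → Instr s' w' q' I' A' O'} {hit : I → Prop} {E : O' → Prop}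

/-- `P'` simulates `P` step by step, unless `P` probes a symbol in `hit`, in which case `P'` halts
with a result in `E`. In the first case the run of `P` does not depend on the symbols in `hit`. -/
theorem Runs.simulate (hcell : Function.Injective cell) (hdec : ∀ v, dec (enc v) = v)
    (hcode : ∀ p, P'.code (κ p) = (P.code p).lift cell enc dec κ onProbe onHalt)
    (hhit : ∀ p x next, P'.code p = onProbe x next → hit x →
      ∀ μ, ∃ o, E o ∧ P'.Runs inp' p μ 1 o μ)
    (hmiss : ∀ p x next, P'.code p = onProbe x next → ¬ hit x → ∀ μ t o μ',
      P'.Runs inp' (next (inp x)) μ t o μ' → P'.Runs inp' p μ (t + 1) o μ')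
    {p : Fin q} {μ μ' : Memory s w} {t : ℕ} {o : O} (r : P.Runs inp p μ t o μ') :
    ∀ ν : Memory s' w', (∀ i, ν (cell i) = enc (μ i)) →
      (∃ t' ≤ t, ∃ o' ν', E o' ∧ (∀ c, (∀ i, c ≠ cell i) → ν' c = ν c) ∧
        P'.Runs inp' (κ p) ν t' o' ν') ∨
      ((∃ pf ν', P.code pf = .halt o ∧ (∀ i, ν' (cell i) = enc (μ' i)) ∧
          (∀ c, (∀ i, c ≠ cell i) → ν' c = ν c) ∧
          ∀ t₂ o₂ ν₂, P'.Runs inp' (κ pf) ν' t₂ o₂ ν₂ → P'.Runs inp' (κ p) ν (t + t₂) o₂ ν₂) ∧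
        ∀ inp₂ : I → A, (∀ x, ¬ hit x → inp₂ x = inp x) → P.Runs inp₂ p μ t o μ') := by
  induction r with
  | @halt p μ o h =>
    intro ν hν
    right
    refine ⟨⟨p, ν, h, hν, fun _ _ => rfl, fun t₂ o₂ ν₂ h₂ => by simpa using h₂⟩, ?_⟩
    exact fun _ _ => .halt h
  | @read p μ μ' t o a next h r ih =>
    intro ν hν
    have hc : P'.code (κ p) = .read (cell a) fun v => κ (next (dec v)) := by
      rw [hcode, h]; rfl
    have hnext : κ (next (dec (ν (cell a)))) = κ (next (μ a)) := by rw [hν, hdec]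
    rcases ih ν hν with ⟨t', ht', o', ν', ho', hfr, r'⟩ | ⟨⟨pf, ν', hpf, hν', hfr, hr⟩, hind⟩
    · left
      refine ⟨t' + 1, by omega, o', ν', ho', hfr, .read hc ?_⟩
      rw [hnext]; exact r'
    · right
      refine ⟨⟨pf, ν', hpf, hν', hfr, fun t₂ o₂ ν₂ h₂ => ?_⟩, fun i₂ hi => .read h (hind i₂ hi)⟩
      rw [add_right_comm]
      refine .read hc ?_
      rw [hnext]; exact hr _ _ _ h₂
  | @write p μ μ' t o a v next h r ih =>
    intro ν hν
    have hc : P'.code (κ p) = .write (cell a) (enc v) (κ next) := by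
      rw [hcode, h]; rfl
    have hν₁ : ∀ i, Function.update ν (cell a) (enc v) (cell i) =
        enc (Function.update μ a v i) := by
      intro i
      by_cases hi : i = a
      · subst hi; simp
      · rw [Function.update_of_ne hi, Function.update_of_ne (hcell.ne hi), hν]
    have hfr₁ : ∀ c, (∀ i, c ≠ cell i) → Function.update ν (cell a) (enc v) c = ν c :=
      fun c hc => Function.update_of_ne (hc a) _ _
    rcases ih _ hν₁ with ⟨t', ht', o', ν', ho', hfr, r'⟩ | ⟨⟨pf, ν', hpf, hν', hfr, hr⟩, hind⟩
    · left
      exact ⟨t' + 1, by omega, o', ν', ho', fun c hc => (hfr c hc).trans (hfr₁ c hc),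
        .write hc r'⟩
    · right
      refine ⟨⟨pf, ν', hpf, hν', fun c hc => (hfr c hc).trans (hfr₁ c hc),
        fun t₂ o₂ ν₂ h₂ => ?_⟩, fun i₂ hi => .write h (hind i₂ hi)⟩
      rw [add_right_comm]
      exact .write hc (hr _ _ _ h₂)
  | @probe p μ μ' t o x next h r ih =>
    intro ν hν
    have hc : P'.code (κ p) = onProbe x fun a => κ (next a) := by
      rw [hcode, h]; rfl
    -- Only the first hit matters: the simulating machine stops there, so the rest of the run need
    -- not be followed.
    by_cases hx : hit x
    · left
      obtain ⟨o', ho', r'⟩ := hhit _ _ _ hc hx ν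
      exact ⟨1, by omega, o', ν, ho', fun _ _ => rfl, r'⟩
    · rcases ih ν hν with ⟨t', ht', o', ν', ho', hfr, r'⟩ | ⟨⟨pf, ν', hpf, hν', hfr, hr⟩, hind⟩
      · left
        exact ⟨t' + 1, by omega, o', ν', ho', hfr, hmiss _ _ _ hc hx _ _ _ _ r'⟩
      · right
        refine ⟨⟨pf, ν', hpf, hν', hfr, fun t₂ o₂ ν₂ h₂ => ?_⟩, fun i₂ hi => ?_⟩
        · rw [add_right_comm]
          exact hmiss _ _ _ hc hx _ _ _ _ (hr _ _ _ h₂)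
        · refine .probe h ?_
          rw [hi x hx]; exact hind i₂ hi

end Simulation

end Program

/-! ### References and texts encoding a function -/

section Encoding

variable {m n σ N : ℕ} [NeZero n] [NeZero N]

/-- The reference encoding `f` by the code words `ρ`: the block number `x` is the code word of
`f x`. -/
def encodeRef (m : ℕ) (sym : Bool → Fin σ) (ρ : Fin N → Fin n → Bool) (f : Fin N → Fin N)
    (i : Fin m) : Fin σ :=
  if h : i / n < N then sym (ρ (f ⟨i / n, h⟩) (Fin.ofNat n i)) else sym false

/-- The position `i` of the reference lies in a block that encodes the value `y`. -/
def IsHit (f : Fin N → Fin N) (n : ℕ) (y : Fin N) (i : ℕ) : Prop :=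
  ∃ h : i / n < N, f ⟨i / n, h⟩ = y

open Classical in
/-- The reference encoding `f`, with the blocks encoding the value `y` blanked out. -/
noncomputable def maskedRef (m : ℕ) (sym : Bool → Fin σ) (ρ : Fin N → Fin n → Bool)
    (f : Fin N → Fin N) (y : Fin N) (i : Fin m) : Fin σ :=
  if IsHit f n y i then sym false else encodeRef m sym ρ f i

omit [NeZero N] in
theorem maskedRef_of_not_isHit {sym : Bool → Fin σ} {ρ : Fin N → Fin n → Bool}
    {f : Fin N → Fin N} {y : Fin N} {i : Fin m} (h : ¬ IsHit f n y i) :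
    maskedRef m sym ρ f y i = encodeRef m sym ρ f i := if_neg h

-- Masking removes every occurrence of the code word of `y`, so a decoder that sees only the masked
-- reference learns nothing about it from there.
omit [NeZero N] in
theorem maskedRef_congr {sym : Bool → Fin σ} {ρ ρ' : Fin N → Fin n → Bool} {f : Fin N → Fin N}
    {y : Fin N} (h : ∀ z, z ≠ y → ρ z = ρ' z) :
    maskedRef m sym ρ f y = maskedRef m sym ρ' f y := by
  funext i
  unfold maskedRef
  split_ifs with hi
  · rfl
  · unfold encodeRef
    split_ifs with hN
    · rw [h _ fun e => hi ⟨hN, e⟩]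
    · rfl

omit [NeZero N] in
/-- The code word of `f x` is a substring of the reference. -/
theorem codeword_infix_encodeRef (hm : N * n ≤ m) (sym : Bool → Fin σ) (ρ : Fin N → Fin n → Bool)
    (f : Fin N → Fin N) (x : Fin N) :
    List.ofFn (fun i => sym (ρ (f x) i)) <:+: List.ofFn (encodeRef m sym ρ f) := by
  have hn : 0 < n := Nat.pos_of_neZero n
  have hx : x * n + n ≤ m := by
    calc x * n + n = (x + 1) * n := by ring
      _ ≤ N * n := Nat.mul_le_mul_right _ x.2
      _ ≤ m := hm
  have key : List.ofFn (fun i => sym (ρ (f x) i)) =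
      ((List.ofFn (encodeRef m sym ρ f)).drop (x * n)).take n := by
    apply List.ext_getElem
    · simp; omega
    · intro i h₁ h₂
      have hi : i < n := by simpa using h₁
      have hdiv : (x * n + i) / n = x := by
        rw [mul_comm, Nat.mul_add_div hn, Nat.div_eq_of_lt hi, add_zero]
      have hmod : Fin.ofNat n (x * n + i) = ⟨i, hi⟩ := by
        apply Fin.ext
        simp [Fin.ofNat, Nat.mod_eq_of_lt hi]
      simp only [List.getElem_ofFn, List.getElem_take, List.getElem_drop, encodeRef, hdiv, x.2,
        dite_true, hmod]
  rw [key]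
  exact (List.take_prefix _ _).isInfix.trans (List.drop_suffix _ _).isInfix

end Encoding

/-- One factor and no single symbols suffice, whatever the number of permitted errors. -/
theorem factorizable_of_infix {α : Type} (k : ℕ) {R X : List α} (h : X <:+: R) :
    Factorizable k R X :=
  ⟨[(false, X)], by simp, by simpa using h, by simp, by simp⟩

/-! ### Good code words -/

namespace OfflineRA

variable {m n σ N : ℕ} [NeZero n] [NeZero N]

/-- Some memory content allows to recover the code word of `y` without access to the blocks that
encode `y`. -/
def Compresses (D : OfflineRA m n σ) (sym : Bool → Fin σ) (f : Fin N → Fin N)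
    (ρ : Fin N → Fin n → Bool) (y : Fin N) : Prop :=
  ∃ μ ts, D.query.Serves (maskedRef m sym ρ f y) (fun i o => o = sym (ρ y i)) μ
    (List.finRange n) ts

open Classical in
omit [NeZero N] in
/-- For all but `2 ^ space` of the possible code words of `y`, there is no such memory content. -/
theorem card_compresses_mul_le (D : OfflineRA m n σ) {sym : Bool → Fin σ}
    (hsym : Function.Injective sym) (f : Fin N → Fin N) (y : Fin N) :
    (Finset.univ.filter fun ρ => D.Compresses sym f ρ y).card * 2 ^ n ≤
      2 ^ D.space * 2 ^ (n * N) := by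
  -- A witnessing memory for each compressible table; the default value is never used, because `Φ`
  -- is only considered on `B`.
  let g : (Fin N → Fin n → Bool) → Memory D.cells D.wordBits := fun ρ =>
    if h : D.Compresses sym f ρ y then h.choose else fun _ => 0
  let B := Finset.univ.filter fun ρ => D.Compresses sym f ρ y
  -- Injective encoding: the row `y` is overwritten by an arbitrary `v`, and the memory alone has to
  -- make up for the lost row.
  let Φ : (Fin N → Fin n → Bool) × (Fin n → Bool) →
      Memory D.cells D.wordBits × (Fin N → Fin n → Bool) :=
    fun p => (g p.1, Function.update p.1 y p.2)
  have hinj : Set.InjOn Φ ((B ×ˢ Finset.univ : Finset ((Fin N → Fin n → Bool) × (Fin n → Bool))) :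
      Set ((Fin N → Fin n → Bool) × (Fin n → Bool))) := by
    rintro ⟨ρ, v⟩ h₁ ⟨ρ', v'⟩ h₂ h
    have hρ : D.Compresses sym f ρ y := by simpa [B] using h₁
    have hρ' : D.Compresses sym f ρ' y := by simpa [B] using h₂
    have hg : g ρ = g ρ' := congrArg Prod.fst h
    have hu : Function.update ρ y v = Function.update ρ' y v' := congrArg Prod.snd h
    have hv : v = v' := by simpa using congrFun hu y
    have hne : ∀ z, z ≠ y → ρ z = ρ' z := fun z hz => by
      simpa [Function.update_of_ne hz] using congrFun hu z
    -- Both rows are decoded by the same deterministic queries from the same memory and the same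
    -- masked reference.
    have hy : ρ y = ρ' y := by
      obtain ⟨ts, hts⟩ := hρ.choose_spec
      obtain ⟨ts', hts'⟩ := hρ'.choose_spec
      have e₁ : hρ.choose = g ρ := by simp only [g, dif_pos hρ]
      have e₂ : hρ'.choose = g ρ := by rw [hg]; simp only [g, dif_pos hρ']
      rw [e₁] at hts
      rw [e₂, ← maskedRef_congr hne] at hts'
      funext i
      exact hsym (hts.unique hts' i (List.mem_finRange i))
    have : ρ = ρ' := by
      funext z
      by_cases hz : z = y
      · rw [hz, hy]
      · exact hne z hz
    rw [this, hv]
  have hcard := Finset.card_le_card_of_injOn (t := Finset.univ) Φ (by simp) hinj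
  simpa [B, Finset.card_product, Memory, OfflineRA.space, ← pow_mul, mul_comm, mul_left_comm]
    using hcard

/-- If the memory is much smaller than the texts, then there are `N` tables of code words such that
every function has, in one of them, incompressible code words. -/
theorem exists_incompressible_family (D : OfflineRA m n σ) {sym : Bool → Fin σ}
    (hsym : Function.Injective sym) (hspace : N ^ 2 * 2 ^ D.space < 2 ^ n) :
    ∃ fam : Fin N → Fin N → Fin n → Bool, ∀ f : Fin N → Fin N, ∃ j, ∀ y,
      ¬ D.Compresses sym f (fam j) y := by
  classical
  by_contra! hcon
  have hN : 0 < N := Nat.pos_of_neZero N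
  let B : (Fin N → Fin N) → Finset (Fin N → Fin n → Bool) := fun f =>
    Finset.univ.filter fun ρ => ∃ y, D.Compresses sym f ρ y
  have hB : ∀ f, (B f).card * 2 ^ n ≤ N * (2 ^ D.space * 2 ^ (n * N)) := by
    intro f
    have hsub : B f = Finset.univ.biUnion fun y =>
        Finset.univ.filter fun ρ => D.Compresses sym f ρ y := by
      ext ρ; simp [B]
    calc (B f).card * 2 ^ n
        ≤ (∑ y : Fin N, (Finset.univ.filter fun ρ => D.Compresses sym f ρ y).card) * 2 ^ n := by
          rw [hsub]; exact Nat.mul_le_mul_right _ Finset.card_biUnion_le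
      _ = ∑ y : Fin N, (Finset.univ.filter fun ρ => D.Compresses sym f ρ y).card * 2 ^ n :=
          Finset.sum_mul _ _ _
      _ ≤ ∑ _y : Fin N, 2 ^ D.space * 2 ^ (n * N) :=
          Finset.sum_le_sum fun y _ => D.card_compresses_mul_le hsym f y
      _ = N * (2 ^ D.space * 2 ^ (n * N)) := by simp
  -- One factor `N` of `hspace` pays for the union bound over `y`; the other leaves a failure
  -- probability below `1 / N`.
  have hlt : ∀ f, N * (B f).card < 2 ^ (n * N) := by
    intro f
    have h2 : 0 < 2 ^ (n * N) := by positivity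
    have : N * (B f).card * 2 ^ n < 2 ^ (n * N) * 2 ^ n := by
      calc N * (B f).card * 2 ^ n = N * ((B f).card * 2 ^ n) := by ring
        _ ≤ N * (N * (2 ^ D.space * 2 ^ (n * N))) := Nat.mul_le_mul_left _ (hB f)
        _ = 2 ^ (n * N) * (N ^ 2 * 2 ^ D.space) := by ring
        _ < 2 ^ (n * N) * 2 ^ n := Nat.mul_lt_mul_of_pos_left hspace h2
    exact lt_of_mul_lt_mul_right this (Nat.zero_le _)
  have hcover : (Finset.univ : Finset (Fin N → Fin N → Fin n → Bool)) ⊆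
      Finset.univ.biUnion fun f : Fin N → Fin N => Fintype.piFinset fun _ => B f := by
    intro fam _
    obtain ⟨f, hf⟩ := hcon fam
    simp only [Finset.mem_biUnion, Finset.mem_univ, true_and, Fintype.mem_piFinset]
    exact ⟨f, fun j => by simpa [B] using hf j⟩
  have h₁ : (2 ^ (n * N)) ^ N ≤ ∑ f : Fin N → Fin N, (B f).card ^ N := by
    have := (Finset.card_le_card hcover).trans Finset.card_biUnion_le
    simpa [Fintype.card_piFinset_const, ← pow_mul] using this
  have h₂ : ∑ f : Fin N → Fin N, (B f).card ^ N < (2 ^ (n * N)) ^ N := by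
    have hpos : 0 < N ^ N := by positivity
    -- The factor `N ^ N` is the number of functions; distributed over the summands, it turns each
    -- into the `N`-th power of `N * (B f).card`.
    refine lt_of_mul_lt_mul_left (a := N ^ N) ?_ (Nat.zero_le _)
    calc N ^ N * ∑ f : Fin N → Fin N, (B f).card ^ N
        = ∑ f : Fin N → Fin N, (N * (B f).card) ^ N := by
          rw [Finset.mul_sum]; simp_rw [mul_pow]
      _ < ∑ _f : Fin N → Fin N, (2 ^ (n * N)) ^ N :=
          Finset.sum_lt_sum_of_nonempty Finset.univ_nonempty
            fun f _ => Nat.pow_lt_pow_left (hlt f) hN.ne'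
      _ = N ^ N * (2 ^ (n * N)) ^ N := by simp
  exact absurd h₁ (not_le.2 h₂)

end OfflineRA

/-! ### The inversion algorithm -/

/-- The control states of the inversion algorithm: `y` is the value to be inverted, `j` the number
of the table of code words. -/
inductive InvState (N n s w q : ℕ) : Type
  | init (y : Fin N)
  | copyRead (y j : Fin N) (i : Fin (s + 1))
  | copyWrite (y j : Fin N) (i : Fin s) (v : Fin (2 ^ w))
  | construct (y j : Fin N) (p : Fin q)
  | query (y j : Fin N) (i : Fin n) (p : Fin q)
  | done (o : Option (Fin N))

namespace InvState

variable {N n s w q : ℕ}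

/-- The control states as a sum of products of finite types. -/
def equivSum : InvState N n s w q ≃
    Fin N ⊕ (Fin N × Fin N × Fin (s + 1)) ⊕ (Fin N × Fin N × Fin s × Fin (2 ^ w)) ⊕
      (Fin N × Fin N × Fin q) ⊕ (Fin N × Fin N × Fin n × Fin q) ⊕ Option (Fin N) where
  toFun
    | init y => .inl y
    | copyRead y j i => .inr (.inl (y, j, i))
    | copyWrite y j i v => .inr (.inr (.inl (y, j, i, v)))
    | construct y j p => .inr (.inr (.inr (.inl (y, j, p))))
    | query y j i p => .inr (.inr (.inr (.inr (.inl (y, j, i, p)))))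
    | done o => .inr (.inr (.inr (.inr (.inr o))))
  invFun
    | .inl y => init y
    | .inr (.inl (y, j, i)) => copyRead y j i
    | .inr (.inr (.inl (y, j, i, v))) => copyWrite y j i v
    | .inr (.inr (.inr (.inl (y, j, p)))) => construct y j p
    | .inr (.inr (.inr (.inr (.inl (y, j, i, p))))) => query y j i p
    | .inr (.inr (.inr (.inr (.inr o)))) => done o
  left_inv a := by cases a <;> rfl
  right_inv a := by rcases a with _ | _ | _ | _ | _ | _ <;> rfl

instance : Fintype (InvState N n s w q) := Fintype.ofEquiv _ equivSum.symm

theorem card_eq : Fintype.card (InvState N n s w q) =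
    N + (N * (N * (s + 1)) + (N * (N * (s * 2 ^ w)) +
      (N * (N * q) + (N * (N * (n * q)) + (N + 1))))) := by
  rw [Fintype.card_congr equivSum]
  simp

/-- The numbering of the control states. -/
noncomputable def code : InvState N n s w q ≃ Fin (Fintype.card (InvState N n s w q)) :=
  Fintype.equivFin _

end InvState

/-- The memory cells of the inversion algorithm: a backup of the preprocessed memory, a working
copy of it, and the number of the table of code words. -/
noncomputable def invCell (s : ℕ) : (Fin s ⊕ Fin s) ⊕ Unit ≃ Fin (s + s + 1) :=
  Fintype.equivFinOfCardEq (by simp)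

/-- A word, stored in a longer word. -/
def extendWord (L : ℕ) {w : ℕ} (v : Fin (2 ^ w)) : Fin (2 ^ (w + L)) :=
  Fin.castLE (Nat.pow_le_pow_right (by norm_num) (Nat.le_add_right w L)) v

/-- The inverse of `extendWord`. -/
def truncateWord (L : ℕ) {w : ℕ} (v : Fin (2 ^ (w + L))) : Fin (2 ^ w) :=
  Fin.ofNat (2 ^ w) v

theorem truncateWord_extendWord {L w : ℕ} (v : Fin (2 ^ w)) :
    truncateWord L (extendWord L v) = v := by
  apply Fin.ext
  simp [truncateWord, extendWord, Fin.ofNat, Nat.mod_eq_of_lt v.2]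

namespace OfflineRA

variable {m n σ N : ℕ} [NeZero n] [NeZero N]

section Inverter

variable (D : OfflineRA m n σ) (sym : Bool → Fin σ) (fam : Fin N → Fin N → Fin n → Bool)
  (L : ℕ)

/-- The instructions of the inversion algorithm. -/
abbrev InvInstr (N : ℕ) (D : OfflineRA m n σ) (L : ℕ) : Type :=
  Instr (D.cells + D.cells + 1) (D.wordBits + L)
    (Fintype.card (InvState N n D.cells D.wordBits D.states)) (Fin N) (Fin N) (Option (Fin N))

/-- A step that only changes the control state. -/
noncomputable def skip (a : Fin (Fintype.card (InvState N n D.cells D.wordBits D.states))) :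
    InvInstr N D L :=
  .read (invCell _ (.inr ())) fun _ => a

/-- A probe of the reference: evaluate `f`, and stop if it has the value `y`. -/
noncomputable def probeRef (y j : Fin N) (i : Fin m)
    (next : Fin σ → Fin (Fintype.card (InvState N n D.cells D.wordBits D.states))) :
    InvInstr N D L :=
  if h : i / n < N then
    .probe ⟨i / n, h⟩ fun z =>
      if z = y then InvState.code (.done (some ⟨i / n, h⟩))
      else next (sym (fam j z (Fin.ofNat n i)))
  else D.skip L (next (sym false))

/-- A probe of the reference or of the text. -/
noncomputable def probeInput (y j : Fin N) :
    Fin m ⊕ Fin n → (Fin σ → Fin (Fintype.card (InvState N n D.cells D.wordBits D.states))) →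
      InvInstr N D L
  | .inl i, next => D.probeRef sym fam L y j i next
  | .inr i, next => D.skip L (next (sym (fam j y i)))

/-- The control state in which the `i`-th query to the random access structure starts. -/
noncomputable def startQuery (y j : Fin N) (i : ℕ) :
    InvState N n D.cells D.wordBits D.states :=
  -- The result after the last query is arbitrary: with incompressible code words, a hit occurs
  -- before all queries are finished.
  if h : i < n then .query y j ⟨i, h⟩ (D.query.start ⟨i, h⟩) else .done none

/-- The instruction of the inversion algorithm in a given control state. -/
noncomputable def invCode : InvState N n D.cells D.wordBits D.states → InvInstr N D L
  | .init y => .read (invCell _ (.inr ())) fun v => InvState.code (.copyRead y (Fin.ofNat N v) 0)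
  | .copyRead y j i =>
    if h : (i : ℕ) < D.cells then
      .read (invCell _ (.inl (.inl ⟨i, h⟩))) fun v =>
        InvState.code (.copyWrite y j ⟨i, h⟩ (truncateWord L v))
    else D.skip L (InvState.code (.construct y j (D.construct.start ())))
  | .copyWrite y j i v =>
    .write (invCell _ (.inl (.inr i))) (extendWord L v) (InvState.code (.copyRead y j i.succ))
  | .construct y j p =>
    (D.construct.code p).lift (fun i => invCell _ (.inl (.inr i))) (extendWord L) (truncateWord L)
      (fun p => InvState.code (.construct y j p)) (D.probeInput sym fam L y j)
      fun h : Fin (n + 1) => D.skip L (InvState.code (if (h : ℕ) < n then .done none else D.startQuery y j 0))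
  | .query y j i p =>
    (D.query.code p).lift (fun i => invCell _ (.inl (.inr i))) (extendWord L) (truncateWord L)
      (fun p => InvState.code (.query y j i p)) (D.probeRef sym fam L y j)
      fun _ => D.skip L (InvState.code (D.startQuery y j (i + 1)))
  | .done o => .halt o

/-- The program of the inversion algorithm. -/
noncomputable def invProgram : Program (D.cells + D.cells + 1) (D.wordBits + L)
    (Fintype.card (InvState N n D.cells D.wordBits D.states)) (Fin N) (Fin N) (Fin N)
    (Option (Fin N)) where
  start y := InvState.code (.init y)
  code p := D.invCode sym fam L (InvState.code.symm p)

theorem invProgram_code (a : InvState N n D.cells D.wordBits D.states) :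
    (D.invProgram sym fam L).code (InvState.code a) = D.invCode sym fam L a := by
  simp [invProgram]

/-- The backup of the preprocessed memory and the number of the table are intact. -/
def Intact (μ₀ : Memory D.cells D.wordBits) (j : Fin N)
    (ν : Memory (D.cells + D.cells + 1) (D.wordBits + L)) : Prop :=
  (∀ i, ν (invCell _ (.inl (.inl i))) = extendWord L (μ₀ i)) ∧
    (ν (invCell _ (.inr ())) : ℕ) = j

/-- The working copy of the memory has the content `μ`. -/
def Holds (μ : Memory D.cells D.wordBits)
    (ν : Memory (D.cells + D.cells + 1) (D.wordBits + L)) : Prop :=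
  ∀ i, ν (invCell _ (.inl (.inr i))) = extendWord L (μ i)

/-! ### Correctness and running time of the inversion algorithm -/

variable {D L}

-- A simulated run writes only to the working copy, so backup and table number survive it.
omit [NeZero n] [NeZero N] in
theorem Intact.congr {μ₀ : Memory D.cells D.wordBits} {j : Fin N}
    {ν ν' : Memory (D.cells + D.cells + 1) (D.wordBits + L)} (h : D.Intact L μ₀ j ν)
    (hν : ∀ c, (∀ i, c ≠ invCell _ (.inl (.inr i))) → ν' c = ν c) : D.Intact L μ₀ j ν' := by
  refine ⟨fun i => ?_, ?_⟩
  · rw [hν _ (by simp), h.1]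
  · rw [hν _ (by simp), h.2]

variable {sym fam} {f : Fin N → Fin N}

theorem runs_skip {p a : Fin (Fintype.card (InvState N n D.cells D.wordBits D.states))}
    (hp : (D.invProgram sym fam L).code p = D.skip L a)
    {ν ν' : Memory (D.cells + D.cells + 1) (D.wordBits + L)} {t : ℕ} {o : Option (Fin N)}
    (r : (D.invProgram sym fam L).Runs f a ν t o ν') :
    (D.invProgram sym fam L).Runs f p ν (t + 1) o ν' :=
  .read hp r

theorem runs_done (o : Option (Fin N))
    (ν : Memory (D.cells + D.cells + 1) (D.wordBits + L)) :
    (D.invProgram sym fam L).Runs f (InvState.code (.done o)) ν 0 o ν :=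
  .halt (by rw [invProgram_code]; rfl)

theorem runs_probeRef_of_isHit {y j : Fin N}
    {p : Fin (Fintype.card (InvState N n D.cells D.wordBits D.states))} {i : Fin m}
    {next : Fin σ → Fin (Fintype.card (InvState N n D.cells D.wordBits D.states))}
    (hp : (D.invProgram sym fam L).code p = D.probeRef sym fam L y j i next)
    (hi : IsHit f n y i) (ν : Memory (D.cells + D.cells + 1) (D.wordBits + L)) :
    ∃ o, (∃ x, o = some x ∧ f x = y) ∧ (D.invProgram sym fam L).Runs f p ν 1 o ν := by
  obtain ⟨h, hy⟩ := hi
  refine ⟨some ⟨i / n, h⟩, ⟨_, rfl, hy⟩, ?_⟩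
  rw [probeRef, dif_pos h] at hp
  refine .probe hp ?_
  rw [if_pos hy]
  exact runs_done _ _

/-- One evaluation of `f` gives the value encoded by the block, and the advice table supplies the
symbol; beyond the last block the symbol is constant and `f` is not needed. -/
theorem runs_probeRef_of_not_isHit {y j : Fin N}
    {p : Fin (Fintype.card (InvState N n D.cells D.wordBits D.states))} {i : Fin m}
    {next : Fin σ → Fin (Fintype.card (InvState N n D.cells D.wordBits D.states))}
    (hp : (D.invProgram sym fam L).code p = D.probeRef sym fam L y j i next)
    (hi : ¬ IsHit f n y i) {ν ν' : Memory (D.cells + D.cells + 1) (D.wordBits + L)} {t : ℕ}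
    {o : Option (Fin N)}
    (r : (D.invProgram sym fam L).Runs f (next (encodeRef m sym (fam j) f i)) ν t o ν') :
    (D.invProgram sym fam L).Runs f p ν (t + 1) o ν' := by
  rw [probeRef] at hp
  by_cases h : i / n < N
  · rw [dif_pos h] at hp
    refine .probe hp ?_
    rw [if_neg fun e => hi ⟨h, e⟩]
    simpa only [encodeRef, dif_pos h] using r
  · rw [dif_neg h] at hp
    refine runs_skip hp ?_
    simpa only [encodeRef, dif_neg h] using r

/-- The algorithm finds a preimage while it runs the random access queries, or these queries do not
depend on the blocks that encode `y`. -/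
theorem startQuery_runs (μ₀ : Memory D.cells D.wordBits) (y j : Fin N) {xs : List (Fin n)}
    {μ : Memory D.cells D.wordBits} {ts : List ℕ} {ok : Fin n → Fin σ → Prop}
    (hs : D.query.Serves (encodeRef m sym (fam j) f) ok μ xs ts) :
    ∀ (i : ℕ), (List.finRange n).drop i = xs →
    ∀ ν, D.Intact L μ₀ j ν → D.Holds L μ ν →
      (∃ t' ≤ ts.sum + xs.length, ∃ o ν', (∃ x, o = some x ∧ f x = y) ∧ D.Intact L μ₀ j ν' ∧
        (D.invProgram sym fam L).Runs f (InvState.code (D.startQuery y j i)) ν t' o ν') ∨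
      D.query.Serves (maskedRef m sym (fam j) f y) ok μ xs ts := by
  induction hs with
  | nil μ => exact fun _ _ _ _ _ => .inr (.nil μ)
  | @cons μ μ' x o t xs ts r hok rest ih =>
    intro i hi ν hν hμ
    have hin : i < n := by
      by_contra h
      rw [List.drop_eq_nil_of_le (by simpa using h)] at hi
      cases hi
    rw [List.drop_eq_getElem_cons (by simpa using hin)] at hi
    obtain ⟨hx, hxs⟩ := List.cons.inj hi
    have hx' : x = ⟨i, hin⟩ := by rw [← hx]; simp
    subst hx'
    have hstart : D.startQuery y j i = .query y j ⟨i, hin⟩ (D.query.start ⟨i, hin⟩) := by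
      rw [startQuery, dif_pos hin]
    rw [hstart]
    rcases r.simulate (P' := D.invProgram sym fam L) (inp' := f)
        (cell := fun i => invCell _ (.inl (.inr i)))
        (enc := extendWord L) (dec := truncateWord L)
        (κ := fun p => InvState.code (.query y j ⟨i, hin⟩ p))
        (onProbe := D.probeRef sym fam L y j)
        (onHalt := fun _ => D.skip L (InvState.code (D.startQuery y j (i + 1))))
        (hit := fun a => IsHit f n y a) (E := fun o => ∃ x, o = some x ∧ f x = y)
        (fun a b hab => by simpa using hab) truncateWord_extendWord
        (fun p => by rw [invProgram_code]; rfl)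
        (fun p a next hp ha ν => runs_probeRef_of_isHit hp ha ν)
        (fun p a next hp ha ν t o ν' r => runs_probeRef_of_not_isHit hp ha r) ν hμ with
      ⟨t', ht', o', ν', ho', hfr, r'⟩ | ⟨⟨pf, ν', hpf, hμ', hfr, hr⟩, hind⟩
    · left
      refine ⟨t', ?_, o', ν', ho', hν.congr hfr, r'⟩
      simp; omega
    · rcases ih (i + 1) hxs ν' (hν.congr hfr) hμ' with ⟨t₂, ht₂, o₂, ν₂, ho₂, hν₂, r₂⟩ | hs
      · left
        -- The additional step is the transition from the end of one query to the start of the next;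
        -- it is paid for by `xs.length`.
        refine ⟨t + (t₂ + 1), ?_, o₂, ν₂, ho₂, hν₂, hr _ _ _ (runs_skip ?_ r₂)⟩
        · simp; omega
        · rw [invProgram_code, invCode, hpf]; rfl
      · right
        -- The query probed no block of `y`, and elsewhere the masked reference agrees with the true
        -- one.
        exact .cons (hind _ fun a ha => maskedRef_of_not_isHit ha) hok hs

/-- The algorithm restores the working copy of the memory. -/
theorem copyRead_runs {μ₀ : Memory D.cells D.wordBits} {y j : Fin N} (d : ℕ) :
    ∀ (i : Fin (D.cells + 1)), (i : ℕ) + d = D.cells →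
    ∀ ν, D.Intact L μ₀ j ν →
      (∀ a : Fin D.cells, (a : ℕ) < i → ν (invCell _ (.inl (.inr a))) = extendWord L (μ₀ a)) →
      ∃ ν', D.Intact L μ₀ j ν' ∧ D.Holds L μ₀ ν' ∧
        ∀ t o ν₂, (D.invProgram sym fam L).Runs f
            (InvState.code (.construct y j (D.construct.start ()))) ν' t o ν₂ →
          (D.invProgram sym fam L).Runs f (InvState.code (.copyRead y j i)) ν
            (t + 1 + 2 * d) o ν₂ := by
  induction d with
  | zero =>
    intro i hi ν hν hcop
    -- Leaving the loop costs one step; copying a cell costs two, a read and a write.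
    refine ⟨ν, hν, fun a => hcop a (by omega), fun t o ν₂ r => runs_skip ?_ r⟩
    rw [invProgram_code, invCode, dif_neg (by omega)]
  | succ d ih =>
    intro i hi ν hν hcop
    have hlt : (i : ℕ) < D.cells := by omega
    let ν₁ := Function.update ν (invCell _ (.inl (.inr ⟨i, hlt⟩))) (extendWord L (μ₀ ⟨i, hlt⟩))
    have hν₁ : D.Intact L μ₀ j ν₁ :=
      hν.congr fun c hc => Function.update_of_ne (hc _) _ _
    have hcop₁ : ∀ a : Fin D.cells, (a : ℕ) < (Fin.succ ⟨i, hlt⟩ : Fin (D.cells + 1)) →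
        ν₁ (invCell _ (.inl (.inr a))) = extendWord L (μ₀ a) := by
      intro a ha
      by_cases hai : a = ⟨i, hlt⟩
      · subst hai; simp [ν₁]
      · have hne : (a : ℕ) ≠ i := fun e => hai (Fin.ext e)
        have : (a : ℕ) < i := by simp at ha; omega
        simp only [ν₁]
        rw [Function.update_of_ne (by simpa using hai), hcop a this]
    obtain ⟨ν', h₁, h₂, h₃⟩ := ih (Fin.succ ⟨i, hlt⟩) (by simp; omega) ν₁ hν₁ hcop₁
    refine ⟨ν', h₁, h₂, fun t o ν₂ r => ?_⟩
    have e : t + 1 + 2 * (d + 1) = t + 1 + 2 * d + 1 + 1 := by ring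
    rw [e]
    refine .read (by rw [invProgram_code, invCode, dif_pos hlt]) ?_
    rw [hν.1, truncateWord_extendWord]
    refine .write (by rw [invProgram_code, invCode]) ?_
    exact h₃ t o ν₂ r

/-- Incompressibility turns a full support-length into a hit: otherwise the memory left by the
construction would decode the code word of `y`. A smaller support-length rules out a preimage,
because its block would contain the whole text. In the time bound, the 3 counts reading the table
number, leaving the copy loop and leaving the construction; the summand `n` counts the transitions
after the queries. -/
theorem inverter_runs {k : ℕ} {Tc Tq : ℝ} (hD : D.Correct k Tc Tq) (hm : N * n ≤ m)
    (hTq : 0 ≤ Tq) {j : Fin N} (hj : ∀ y, ¬ D.Compresses sym f (fam j) y) (y : Fin N)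
    (ν : Memory (D.cells + D.cells + 1) (D.wordBits + L))
    (hν : D.Intact L (D.preprocess (encodeRef m sym (fam j) f)) j ν) :
    ∃ t o ν', (D.invProgram sym fam L).Runs f ((D.invProgram sym fam L).start y) ν t o ν' ∧
      FunctionInverter.IsAnswer f y o ∧
      D.Intact L (D.preprocess (encodeRef m sym (fam j) f)) j ν' ∧
      (t : ℝ) ≤ Tc + n * Tq + 2 * D.cells + n + 3 := by
  set R := encodeRef m sym (fam j) f with hR
  obtain ⟨t, h, μ, r, hfac, hq⟩ := hD R fun i => sym (fam j y i)
  obtain ⟨ν₁, hint₁, hold₁, hrun₁⟩ := copyRead_runs (sym := sym) (fam := fam) (f := f)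
    (y := y) D.cells 0 (by simp) ν hν (by simp)
  have hstart : ∀ t o ν₂, (D.invProgram sym fam L).Runs f
        (InvState.code (.construct y j (D.construct.start ()))) ν₁ t o ν₂ →
      (D.invProgram sym fam L).Runs f ((D.invProgram sym fam L).start y) ν
        (t + 1 + 2 * D.cells + 1) o ν₂ := by
    intro t o ν₂ r
    have hc : (D.invProgram sym fam L).code ((D.invProgram sym fam L).start y) =
        .read (invCell _ (.inr ())) fun v =>
          InvState.code (.copyRead y (Fin.ofNat N v) 0) :=
      invProgram_code D sym fam L (.init y)
    refine .read hc ?_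
    have hj' : Fin.ofNat N (ν (invCell _ (.inr ())) : ℕ) = j := by
      apply Fin.ext
      simp [Fin.ofNat, hν.2, Nat.mod_eq_of_lt j.2]
    rw [hj']
    exact hrun₁ t o ν₂ r
  -- The amortized bound with no queries at all bounds the construction alone.
  have ht0 : (t : ℝ) ≤ Tc := by
    obtain ⟨ts, hts, hle⟩ := hq [] (by simp)
    cases hts
    simpa using hle
  -- The independence statement is discarded: `Compresses` admits any memory content, so the
  -- construction may depend on the text and on every block.
  rcases r.simulate (P' := D.invProgram sym fam L) (inp' := f)
      (cell := fun i => invCell _ (.inl (.inr i)))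
      (enc := extendWord L) (dec := truncateWord L)
      (κ := fun p => InvState.code (.construct y j p))
      (onProbe := D.probeInput sym fam L y j)
      (onHalt := fun h : Fin (n + 1) => D.skip L
        (InvState.code (if (h : ℕ) < n then .done none else D.startQuery y j 0)))
      (hit := Sum.elim (fun a => IsHit f n y a) fun _ => False)
      (E := fun o => ∃ x, o = some x ∧ f x = y)
      (fun a b hab => by simpa using hab) truncateWord_extendWord
      (fun p => by rw [invProgram_code]; rfl)
      (by
        rintro p (a | a) next hp ha ν
        · exact runs_probeRef_of_isHit hp ha ν
        · exact ha.elim)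
      (by
        rintro p (a | a) next hp ha ν t o ν' r
        · exact runs_probeRef_of_not_isHit hp ha r
        · exact runs_skip hp r) ν₁ hold₁ with
    ⟨t', ht', o', ν', ho', hfr, r'⟩ | ⟨⟨pf, ν', hpf, hold', hfr, hr⟩, -⟩
  · refine ⟨_, o', ν', hstart _ _ _ r', ?_, hint₁.congr hfr, ?_⟩
    · obtain ⟨x, rfl, hx⟩ := ho'
      exact hx
    · have h1 : (t' : ℝ) ≤ t := by exact_mod_cast ht'
      have h2 : 0 ≤ (n : ℝ) * Tq := by positivity
      have h3 : 0 ≤ (n : ℝ) := by positivity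
      push_cast
      linarith
  · have hcode : (D.invProgram sym fam L).code (InvState.code (.construct y j pf)) =
        D.skip L (InvState.code (if (h : ℕ) < n then .done none else D.startQuery y j 0)) := by
      rw [invProgram_code, invCode, hpf]; rfl
    by_cases hn : (h : ℕ) < n
    · rw [if_pos hn] at hcode
      refine ⟨_, none, ν', hstart _ _ _ (hr _ _ _ (runs_skip hcode (runs_done _ _))), ?_,
        hint₁.congr hfr, ?_⟩
      · rintro x rfl
        exact hfac hn (factorizable_of_infix k
          ((List.drop_suffix _ _).isInfix.trans (codeword_infix_encodeRef hm sym (fam j) f x)))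
      · have h2 : 0 ≤ (n : ℝ) * Tq := by positivity
        have h3 : 0 ≤ (n : ℝ) := by positivity
        push_cast
        linarith
    · rw [if_neg hn] at hcode
      -- Here the support-length equals `n`, so every position may be queried.
      obtain ⟨ts, hts, hle⟩ := hq (List.finRange n) fun i _ => by omega
      rcases startQuery_runs (L := L) (D.preprocess R) y j hts 0 (by simp) ν' (hint₁.congr hfr)
        hold' with ⟨t₂, ht₂, o, ν₂, ho, hint₂, r₂⟩ | hs
      · refine ⟨_, o, ν₂, hstart _ _ _ (hr _ _ _ (runs_skip hcode r₂)), ?_, hint₂, ?_⟩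
        · obtain ⟨x, rfl, hx⟩ := ho
          exact hx
        · have h1 : (t₂ : ℝ) ≤ ts.sum + n := by
            rw [List.length_finRange] at ht₂
            exact_mod_cast ht₂
          rw [List.length_finRange] at hle
          rw [Nat.cast_add] at hle
          rw [Nat.cast_add, Nat.cast_add, Nat.cast_add, Nat.cast_add, Nat.cast_add, Nat.cast_mul]
          simp only [Nat.cast_one, Nat.cast_ofNat]
          linarith
      · exact absurd ⟨μ, ts, hs⟩ (hj y)

end Inverter

/-- An offline random access data structure with little space yields a function inversion data
structure. -/
theorem exists_functionInverter (D : OfflineRA m n σ) {k : ℕ} {Tc Tq : ℝ} (L : ℕ)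
    (hD : D.Correct k Tc Tq) (hTq : 0 ≤ Tq) (hσ : 2 ≤ σ) (hm : N * n ≤ m) (hL : N ≤ 2 ^ L)
    (hspace : N ^ 2 * 2 ^ D.space < 2 ^ n) :
    ∃ F : FunctionInverter N, F.cells = 2 * D.cells + 1 ∧ F.wordBits = D.wordBits + L ∧
      F.states = Fintype.card (InvState N n D.cells D.wordBits D.states) ∧
      F.Correct (Tc + n * Tq + 2 * D.cells + n + 3) := by
  let sym : Bool → Fin σ := fun b => if b then ⟨1, by omega⟩ else ⟨0, by omega⟩
  have hsym : Function.Injective sym := by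
    intro a b
    cases a <;> cases b <;> simp [sym]
  obtain ⟨fam, hfam⟩ := D.exists_incompressible_family hsym hspace
  choose j hj using hfam
  have hL' : N ≤ 2 ^ (D.wordBits + L) :=
    hL.trans (Nat.pow_le_pow_right (by norm_num) (Nat.le_add_left _ _))
  let mem : (Fin N → Fin N) → Memory (D.cells + D.cells + 1) (D.wordBits + L) := fun f c =>
    match (invCell D.cells).symm c with
    | .inl (.inl i) => extendWord L (D.preprocess (encodeRef m sym (fam (j f)) f) i)
    -- Any initial content would do, since each inversion query first overwrites the working copy.
    | .inl (.inr i) => extendWord L (D.preprocess (encodeRef m sym (fam (j f)) f) i)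
    | .inr _ => Fin.castLE hL' (j f)
  refine ⟨⟨D.cells + D.cells + 1, D.wordBits + L, _, ?_, mem, D.invProgram sym fam L⟩,
    by ring, rfl, rfl, fun f ys => ?_⟩
  · exact Nat.add_pos_left D.wordBits_pos _
  · refine Program.exists_serves
      (V := D.Intact L (D.preprocess (encodeRef m sym (fam (j f)) f)) (j f))
      (fun y ν hν => inverter_runs hD hm hTq (hj f) y ν hν) ys (mem f) ⟨fun i => ?_, ?_⟩
    · simp [mem]
    · simp [mem]

end OfflineRA

/-! ### Choice of the parameters -/

/-- For functions `[N] → [N]` one uses a reference of length `m N`, about `(K N) ^ (1 / (1 - χ))`;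
then `m N / N` is about `K (m N) ^ χ`. -/
theorem exists_refLength {χ K : ℝ} (hχ0 : 0 < χ) (hχ1 : χ < 1) (hK : 1 ≤ K) :
    ∃ (m : ℕ → ℕ) (A B : ℝ) (d : ℕ), 1 ≤ A ∧ 1 ≤ B ∧ Tendsto m atTop atTop ∧
      ∀ᶠ N : ℕ in atTop, N ≤ m N ∧ m N ≤ N ^ d ∧ K * (m N : ℝ) ^ χ * N ≤ m N ∧
        (m N : ℝ) ≤ 2 * K * (m N : ℝ) ^ χ * N ∧ (m N : ℝ) ≤ A * (N : ℝ) ^ (1 / (1 - χ)) ∧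
        Real.log (m N) ≤ B * Real.log N := by
  set θ := 1 - χ with hθ
  have hθ0 : 0 < θ := by linarith
  have hθ1 : θ ≤ 1 := by linarith
  have hinv : 1 ≤ 1 / θ := by rw [le_div_iff₀ hθ0]; linarith
  have hA : 1 ≤ 2 * K ^ (1 / θ) := by
    have := Real.one_le_rpow hK (by positivity : 0 ≤ 1 / θ)
    linarith
  have hx : ∀ N : ℕ, 1 ≤ N → (N : ℝ) ≤ (K * N) ^ (1 / θ) := by
    intro N hN
    have hN' : (1 : ℝ) ≤ N := by exact_mod_cast hN
    have h1 : (N : ℝ) ≤ K * N := by nlinarith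
    calc (N : ℝ) ≤ K * N := h1
      _ = (K * N) ^ (1 : ℝ) := (Real.rpow_one _).symm
      _ ≤ (K * N) ^ (1 / θ) := Real.rpow_le_rpow_of_exponent_le (by linarith) hinv
  have hle : ∀ N : ℕ, 1 ≤ N → N ≤ ⌈(K * N) ^ (1 / θ)⌉₊ := fun N hN => by
    exact_mod_cast (hx N hN).trans (Nat.le_ceil _)
  -- The factor 2 absorbs the rounding. In the degree, the summand 1 absorbs the constant `2 * K ^
  -- (1 / θ)`, which is eventually at most `N`.
  refine ⟨fun N => ⌈(K * N) ^ (1 / θ)⌉₊, 2 * K ^ (1 / θ), Real.log (2 * K ^ (1 / θ)) + 1 / θ,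
    ⌈1 / θ⌉₊ + 1, hA, by linarith [Real.log_nonneg hA], ?_, ?_⟩
  · refine tendsto_atTop_mono' _ ?_ tendsto_id
    filter_upwards [eventually_ge_atTop 1] with N hN using hle N hN
  · have hlog : ∀ᶠ N : ℕ in atTop, 1 ≤ Real.log N :=
      (Real.tendsto_log_atTop.comp tendsto_natCast_atTop_atTop).eventually_ge_atTop 1
    have hNA : ∀ᶠ N : ℕ in atTop, 2 * K ^ (1 / θ) ≤ N :=
      tendsto_natCast_atTop_atTop.eventually_ge_atTop _
    filter_upwards [eventually_ge_atTop 1, hlog, hNA] with N hN hlogN hNA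
    have hN' : (1 : ℝ) ≤ N := by exact_mod_cast hN
    have hN0 : (0 : ℝ) < N := by linarith
    set x := (K * N : ℝ) ^ (1 / θ) with hxdef
    set M := ⌈x⌉₊ with hM
    have hx1 : 1 ≤ x := hN'.trans (hx N hN)
    have hxM : x ≤ M := Nat.le_ceil x
    have hMx : (M : ℝ) ≤ 2 * x := by
      have := (Nat.ceil_lt_add_one (by linarith : 0 ≤ x)).le
      rw [← hM] at this
      linarith
    have hM0 : (0 : ℝ) < M := by linarith
    have hxθ : x ^ θ = K * N := by
      rw [hxdef, ← Real.rpow_mul (by positivity), one_div_mul_cancel hθ0.ne', Real.rpow_one]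
    -- Both comparisons of `M` with `K * M ^ χ * N` reduce to `M ^ θ` lying between `K * N` and `2 *
    -- (K * N)`.
    have hsplit : (M : ℝ) = (M : ℝ) ^ χ * (M : ℝ) ^ θ := by
      rw [← Real.rpow_add hM0, hθ]; simp
    have hlow : K * N ≤ (M : ℝ) ^ θ := by
      rw [← hxθ]; exact Real.rpow_le_rpow (by linarith) hxM hθ0.le
    have hupp : (M : ℝ) ^ θ ≤ 2 * (K * N) := by
      calc (M : ℝ) ^ θ ≤ (2 * x) ^ θ := Real.rpow_le_rpow hM0.le hMx hθ0.le
        _ = 2 ^ θ * x ^ θ := Real.mul_rpow (by norm_num) (by linarith)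
        _ ≤ 2 ^ (1 : ℝ) * x ^ θ := by
          have := Real.rpow_le_rpow_of_exponent_le (by norm_num : (1 : ℝ) ≤ 2) hθ1
          gcongr
        _ = 2 * (K * N) := by rw [hxθ, Real.rpow_one]
    have hMχ : 0 < (M : ℝ) ^ χ := by positivity
    have hMA : (M : ℝ) ≤ 2 * K ^ (1 / θ) * (N : ℝ) ^ (1 / θ) := by
      rw [mul_assoc, ← Real.mul_rpow (by linarith) hN0.le]
      exact hMx
    refine ⟨hle N hN, ?_, ?_, ?_, hMA, ?_⟩
    · have : (M : ℝ) ≤ (N : ℝ) ^ (⌈1 / θ⌉₊ + 1) := by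
        calc (M : ℝ) ≤ 2 * K ^ (1 / θ) * (N : ℝ) ^ (1 / θ) := hMA
          _ ≤ N * (N : ℝ) ^ (⌈1 / θ⌉₊ : ℝ) := by
            have := Real.rpow_le_rpow_of_exponent_le hN' (Nat.le_ceil (1 / θ))
            gcongr
          _ = (N : ℝ) ^ (⌈1 / θ⌉₊ + 1) := by rw [Real.rpow_natCast]; ring
      exact_mod_cast this
    · calc K * (M : ℝ) ^ χ * N = (M : ℝ) ^ χ * (K * N) := by ring
        _ ≤ (M : ℝ) ^ χ * (M : ℝ) ^ θ := by gcongr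
        _ = M := hsplit.symm
    · calc (M : ℝ) = (M : ℝ) ^ χ * (M : ℝ) ^ θ := hsplit
        _ ≤ (M : ℝ) ^ χ * (2 * (K * N)) := by gcongr
        _ = 2 * K * (M : ℝ) ^ χ * N := by ring
    · calc Real.log M ≤ Real.log (2 * K ^ (1 / θ) * (N : ℝ) ^ (1 / θ)) :=
            Real.log_le_log hM0 hMA
        _ = Real.log (2 * K ^ (1 / θ)) + 1 / θ * Real.log N := by
          rw [Real.log_mul (by positivity) (by positivity), Real.log_rpow hN0]
        _ ≤ (Real.log (2 * K ^ (1 / θ)) + 1 / θ) * Real.log N := by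
          have := Real.log_nonneg hA
          nlinarith

/-! ### The reduction with explicit constants -/

theorem OfflineRA.Correct.mono {m n σ k : ℕ} {D : OfflineRA m n σ} {Tc Tq Tc' Tq' : ℝ}
    (h : D.Correct k Tc Tq) (hc : Tc ≤ Tc') (hq : Tq ≤ Tq') : D.Correct k Tc' Tq' := by
  intro R T
  obtain ⟨t, l, μ, r, hf, hs⟩ := h R T
  refine ⟨t, l, μ, r, hf, fun is his => ?_⟩
  obtain ⟨ts, hts, hle⟩ := hs is his
  exact ⟨ts, hts, hle.trans (by gcongr)⟩

theorem FunctionInverter.Correct.mono {N : ℕ} {F : FunctionInverter N} {T T' : ℝ}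
    (h : F.Correct T) (hT : T ≤ T') : F.Correct T' := by
  intro f ys
  obtain ⟨ts, hts, hle⟩ := h f ys
  exact ⟨ts, hts, fun t ht => (hle t ht).trans hT⟩

theorem InvState.card_le {N n s w q m c : ℕ} (hm : 2 ≤ m) (hN : N ≤ m) (hn : n ≤ m) (hs : s ≤ m)
    (hw : 2 ^ w ≤ m ^ c) (hq : q ≤ m ^ c) :
    Fintype.card (InvState N n s w q) ≤ m ^ (c + 6) := by
  have hc : 1 ≤ m ^ c := Nat.one_le_pow _ _ (by omega)
  have h1 : 1 ≤ m := by omega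
  rw [InvState.card_eq]
  calc _ ≤ m + (m * (m * (m + 1)) + (m * (m * (m * m ^ c)) +
          (m * (m * m ^ c) + (m * (m * (m * m ^ c)) + (m + 1))))) := by gcongr
    _ ≤ m * m * m * m ^ c + (m * m * m * m ^ c + m * m * m * m ^ c + (m * m * m * m ^ c +
          (m * m * m * m ^ c + (m * m * m * m ^ c + (m * m * m * m ^ c + m * m * m * m ^ c))))) := by
        have h2 : m ≤ m * m := Nat.le_mul_of_pos_left _ h1
        have h3 : m * m ≤ m * m * m := Nat.le_mul_of_pos_right _ h1
        have h4 : m * m * m ≤ m * m * m * m ^ c := Nat.le_mul_of_pos_right _ hc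
        have h5 : m * m * m ^ c ≤ m * m * m * m ^ c :=
          Nat.mul_le_mul_right _ h3
        have e1 : m * (m * (m + 1)) = m * m * m + m * m := by ring
        have e2 : m * (m * (m * m ^ c)) = m * m * m * m ^ c := by ring
        have e3 : m * (m * m ^ c) = m * m * m ^ c := by ring
        rw [e1, e2, e3]
        omega
    _ = 2 ^ 3 * (m ^ 3 * m ^ c) := by ring
    _ ≤ m ^ 3 * (m ^ 3 * m ^ c) := by gcongr
    _ = m ^ (c + 6) := by ring

theorem le_two_mul_log_of_two_pow_le {a x : ℕ} (h : 2 ^ a ≤ x) : (a : ℝ) ≤ 2 * Real.log x := by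
  have h1 : (2 : ℝ) ^ a ≤ x := by exact_mod_cast h
  have h2 := Real.log_le_log (by positivity) h1
  rw [Real.log_pow] at h2
  have := Real.log_two_gt_d9
  have ha : (0 : ℝ) ≤ a := by positivity
  nlinarith

/-- The reduction, with all bounds expressed in the length `m` of the reference. -/
theorem exists_functionInverter_of_bounds {m N k σ c : ℕ} {χ δ C C₁ C₂ K Sra Tc Tq B : ℝ}
    {a₁ a₂ : ℕ} (hRA : ∀ n : ℕ, (n : ℝ) ≤ (m : ℝ) ^ χ * Real.logb 2 m →
      ∃ D : OfflineRA m n σ, (D.space : ℝ) ≤ Sra ∧ 2 ^ D.wordBits ≤ m ^ c ∧ D.states ≤ m ^ c ∧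
        D.Correct k Tc Tq)
    (hσ : 2 ≤ σ) (hχ : 0 < χ) (hδ : 0 < δ) (hC : 0 < C) (hC₁ : 0 < C₁) (hC₂ : 0 < C₂)
    (hK : K = C + 3) (_hB : 1 ≤ B)
    (hS : Sra ≤ C * (m : ℝ) ^ χ)
    (hTc : Tc ≤ C₁ * (Real.log m ^ a₁ * (m : ℝ) ^ (χ + δ)))
    (hTq : Tq ≤ C₂ * (Real.log m ^ a₂ * (m : ℝ) ^ δ))
    (hlogK : 2 * K ≤ Real.log m) (hlogχ : 6 * Real.log m + 1 ≤ 3 * (m : ℝ) ^ χ)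
    (hN2 : 2 ≤ N) (hNm : N ≤ m) (hlow : K * (m : ℝ) ^ χ * N ≤ m)
    (hupp : (m : ℝ) ≤ 2 * K * (m : ℝ) ^ χ * N) (hlogN : 1 ≤ Real.log N)
    (hlog : Real.log m ≤ B * Real.log N) :
    ∃ F : FunctionInverter N,
      (F.space : ℝ) ≤ (2 * C + 1) * (2 * c * B + 3) * (Real.log N * (m : ℝ) ^ χ) ∧
      2 ^ F.wordBits ≤ m ^ (c + 6) ∧ F.states ≤ m ^ (c + 6) ∧
      F.Correct ((C₁ + 2 * K * C₂ + 2 * C + 2 * K + 3) *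
        (Real.log m ^ (a₁ + a₂) * (m : ℝ) ^ (χ + δ))) := by
  have hN0 : (0 : ℝ) < N := by exact_mod_cast (by omega : 0 < N)
  have hm0 : (0 : ℝ) < m := by exact_mod_cast (by omega : 0 < m)
  have hm1 : (1 : ℝ) ≤ m := by exact_mod_cast (by omega : 1 ≤ m)
  have hX : 1 ≤ (m : ℝ) ^ χ := Real.one_le_rpow hm1 hχ.le
  have hNmlog : Real.log N ≤ Real.log m := Real.log_le_log hN0 (by exact_mod_cast hNm)
  set X := (m : ℝ) ^ χ with hXdef
  set n := m / N with hn
  have hnup : (n : ℝ) ≤ 2 * K * X := by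
    refine Nat.cast_div_le.trans ?_
    rw [div_le_iff₀ hN0]; exact hupp
  have hnlow : K * X - 1 ≤ n := by
    have h1 : m < N * (n + 1) := Nat.lt_mul_div_succ m (by omega)
    have h2 : (m : ℝ) < N * (n + 1) := by exact_mod_cast h1
    have h3 : K * X * N ≤ (n + 1) * N := by linarith
    linarith [le_of_mul_le_mul_right h3 hN0]
  -- The logarithm in the permitted text length absorbs the constant `2 * K`.
  have hnlen : (n : ℝ) ≤ X * Real.logb 2 m := by
    have hlogb : Real.log m ≤ Real.logb 2 m := by
      rw [Real.logb, le_div_iff₀ (Real.log_pos (by norm_num))]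
      have := Real.log_two_lt_d9
      nlinarith
    calc (n : ℝ) ≤ 2 * K * X := hnup
      _ ≤ Real.logb 2 m * X := by gcongr; linarith
      _ = X * Real.logb 2 m := mul_comm _ _
  obtain ⟨D, hDS, hDw, hDq, hD⟩ := hRA n hnlen
  have hspace : (D.space : ℝ) ≤ C * X := hDS.trans hS
  have hcells : D.cells ≤ D.space := Nat.le_mul_of_pos_right _ D.wordBits_pos
  have hcells' : (D.cells : ℝ) ≤ C * X := le_trans (by exact_mod_cast hcells) hspace
  set L := Nat.log 2 N + 1 with hL
  have hNL : N < 2 ^ L := Nat.lt_pow_succ_log_self (by norm_num) N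
  have hlogL : (Nat.log 2 N : ℝ) ≤ 2 * Real.log N :=
    le_two_mul_log_of_two_pow_le (Nat.pow_log_le_self 2 (by omega))
  have hLlog : (L : ℝ) ≤ 3 * Real.log N := by rw [hL]; push_cast; linarith
  -- This is why `K = C + 3`: the space takes `C * X`, and `2 * L ≤ 6 * Real.log m ≤ 3 * X - 1`
  -- takes the rest, including the loss from rounding `n` down.
  have hsum : 2 * L + D.space ≤ n := by
    have : (2 * L + D.space : ℝ) ≤ n := by rw [hK] at hnlow; nlinarith
    exact_mod_cast this
  have hpow : N ^ 2 * 2 ^ D.space < 2 ^ n := by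
    calc N ^ 2 * 2 ^ D.space < (2 ^ L) ^ 2 * 2 ^ D.space := by gcongr
      _ = 2 ^ (2 * L + D.space) := by rw [← pow_mul, ← pow_add, mul_comm]
      _ ≤ 2 ^ n := Nat.pow_le_pow_right (by norm_num) hsum
  have hnm : n ≤ m := Nat.div_le_self _ _
  have : NeZero n := ⟨by omega⟩
  have : NeZero N := ⟨by omega⟩
  have hlogm1 : 1 ≤ Real.log m := hlogN.trans hNmlog
  -- Passing to the explicit majorants also makes the query bound nonnegative.
  obtain ⟨F, hFc, hFw, hFs, hF⟩ := D.exists_functionInverter L (hD.mono hTc hTq)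
    (by positivity) hσ (Nat.mul_div_le m N) hNL.le hpow
  refine ⟨F, ?_, ?_, ?_, hF.mono ?_⟩
  · rw [FunctionInverter.space, hFc, hFw]
    have hw : (D.wordBits : ℝ) ≤ 2 * c * B * Real.log N := by
      have h := le_two_mul_log_of_two_pow_le hDw
      push_cast at h
      rw [Real.log_pow] at h
      have : (c : ℝ) * Real.log m ≤ c * (B * Real.log N) := by gcongr
      linarith
    push_cast
    calc (2 * (D.cells : ℝ) + 1) * (D.wordBits + L)
        ≤ (2 * (C * X) + X) * (2 * c * B * Real.log N + 3 * Real.log N) := by gcongr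
      _ = (2 * C + 1) * (2 * c * B + 3) * (Real.log N * X) := by ring
  · rw [hFw, pow_add]
    calc 2 ^ D.wordBits * 2 ^ L = 2 ^ D.wordBits * (2 ^ Nat.log 2 N * 2) := by rw [hL, pow_succ]
      _ ≤ m ^ c * (m * m) := by
        have := Nat.pow_log_le_self 2 (by omega : N ≠ 0)
        gcongr
        · omega
        · omega
      _ = m ^ (c + 2) := by ring
      _ ≤ m ^ (c + 6) := Nat.pow_le_pow_right (by omega) (by omega)
  · rw [hFs]
    exact InvState.card_le (hN2.trans hNm) hNm hnm (by omega) hDw hDq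
  · set l := Real.log (m : ℝ) with hl
    have hpow1 : ∀ a b : ℕ, a ≤ b → l ^ a ≤ l ^ b := fun a b => pow_le_pow_right₀ hlogm1
    set Z := l ^ (a₁ + a₂) * (m : ℝ) ^ (χ + δ) with hZ
    have hY : 1 ≤ (m : ℝ) ^ δ := Real.one_le_rpow hm1 hδ.le
    have hXY : (m : ℝ) ^ (χ + δ) = X * (m : ℝ) ^ δ := Real.rpow_add hm0 _ _
    have hXZ : X ≤ Z := by
      have h1 : 1 ≤ l ^ (a₁ + a₂) := one_le_pow₀ hlogm1
      calc X = 1 * (X * 1) := by ring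
        _ ≤ Z := by rw [hZ, hXY]; gcongr
    have t1 : C₁ * (l ^ a₁ * (m : ℝ) ^ (χ + δ)) ≤ C₁ * Z := by
      have := hpow1 a₁ (a₁ + a₂) (by omega)
      rw [hZ]; gcongr
    have t2 : n * (C₂ * (l ^ a₂ * (m : ℝ) ^ δ)) ≤ 2 * K * C₂ * Z := by
      have := hpow1 a₂ (a₁ + a₂) (by omega)
      have hK0 : 0 < K := by linarith
      calc n * (C₂ * (l ^ a₂ * (m : ℝ) ^ δ))
          ≤ (2 * K * X) * (C₂ * (l ^ (a₁ + a₂) * (m : ℝ) ^ δ)) := by gcongr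
        _ = 2 * K * C₂ * Z := by rw [hZ, hXY]; ring
    have t3 : 2 * (D.cells : ℝ) ≤ 2 * C * Z := by
      linarith [mul_le_mul_of_nonneg_left hXZ hC.le]
    have t4 : (n : ℝ) ≤ 2 * K * Z :=
      hnup.trans (mul_le_mul_of_nonneg_left hXZ (by linarith))
    have t5 : (3 : ℝ) ≤ 3 * Z := by linarith
    linarith

/-! ### The trade-off in terms of `N` -/

theorem mainTheorem4 (k : ℕ) (σ : ℕ → ℕ) (hσ : ∀ m, 2 ≤ σ m)
    (χ δ : ℝ) (hδ : 0 < δ) (hχ : 2 / 5 ≤ χ) (hχ1 : χ < 1)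
    (Sra Tc Tq : ℕ → ℝ)
    (hS : Sra =O[atTop] fun m : ℕ => (m : ℝ) ^ χ)
    (hTc : SoftO Tc fun m : ℕ => (m : ℝ) ^ (χ + δ))
    (hTq : SoftO Tq fun m : ℕ => (m : ℝ) ^ δ)
    (hRA : HasOfflineRandomAccess k σ (fun m : ℕ => (m : ℝ) ^ χ * Real.logb 2 m) Sra Tc Tq)
    (hlt : δ < 3 - 7 * χ) :
    ∃ S T : ℕ → ℝ,
      HasFunctionInversion S T ∧
      (SoftO S fun N : ℕ => (N : ℝ) ^ (χ / (1 - χ))) ∧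
      (SoftO T fun N : ℕ => (N : ℝ) ^ ((χ + δ) / (1 - χ))) ∧
      ImprovesFiatNaor S T := by
  obtain ⟨C, hC, hSC⟩ := hS.exists_pos
  obtain ⟨a₁, hTc⟩ := hTc
  obtain ⟨C₁, hC₁, hTc⟩ := hTc.exists_pos
  obtain ⟨a₂, hTq⟩ := hTq
  obtain ⟨C₂, hC₂, hTq⟩ := hTq.exists_pos
  obtain ⟨c, hRA⟩ := hRA
  have hχ0 : 0 < χ := by linarith
  have hθ : 0 < 1 - χ := by linarith
  obtain ⟨m, A, B, d, hA, hB, hm, hev⟩ :=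
    exists_refLength hχ0 hχ1 (by linarith : 1 ≤ C + 3)
  set Cs := (2 * C + 1) * (2 * c * B + 3) * A ^ χ with hCs
  set Ct := (C₁ + 2 * (C + 3) * C₂ + 2 * C + 2 * (C + 3) + 3) * (B ^ (a₁ + a₂) * A ^ (χ + δ))
    with hCt
  have hlogN : ∀ᶠ N : ℕ in atTop, 1 ≤ Real.log N :=
    (Real.tendsto_log_atTop.comp tendsto_natCast_atTop_atTop).eventually_ge_atTop 1
  have hrpow : ∀ (β : ℝ), 0 ≤ β → ∀ N M : ℕ, (M : ℝ) ≤ A * (N : ℝ) ^ (1 / (1 - χ)) →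
      (M : ℝ) ^ β ≤ A ^ β * (N : ℝ) ^ (β / (1 - χ)) := by
    intro β hβ N M h
    calc (M : ℝ) ^ β ≤ (A * (N : ℝ) ^ (1 / (1 - χ))) ^ β := Real.rpow_le_rpow (by positivity) h hβ
      _ = A ^ β * (N : ℝ) ^ (β / (1 - χ)) := by
        rw [Real.mul_rpow (by linarith) (by positivity), ← Real.rpow_mul (by positivity),
          one_div_mul_eq_div]
  have hmlog : ∀ᶠ M : ℕ in atTop, 2 * (C + 3) ≤ Real.log M :=
    (Real.tendsto_log_atTop.comp tendsto_natCast_atTop_atTop).eventually_ge_atTop _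
  have hmχ : ∀ᶠ M : ℕ in atTop, 6 * Real.log M + 1 ≤ 3 * (M : ℝ) ^ χ := by
    have h1 := ((isLittleO_log_rpow_atTop hχ0).comp_tendsto
      (tendsto_natCast_atTop_atTop (R := ℝ))).bound (by norm_num : (0 : ℝ) < 1 / 3)
    filter_upwards [h1, eventually_ge_atTop 1] with M h hM
    have hM' : (1 : ℝ) ≤ M := by exact_mod_cast hM
    have hX := Real.one_le_rpow hM' hχ0.le
    simp only [Function.comp, Real.norm_eq_abs] at h
    rw [abs_of_nonneg (Real.log_nonneg hM'), abs_of_nonneg (by linarith)] at h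
    linarith
  refine ⟨fun N => Cs * (Real.log N ^ 1 * (N : ℝ) ^ (χ / (1 - χ))),
    fun N => Ct * (Real.log N ^ (a₁ + a₂) * (N : ℝ) ^ ((χ + δ) / (1 - χ))), ?_,
    ⟨1, isBigO_const_mul_self _ _ _⟩, ⟨a₁ + a₂, isBigO_const_mul_self _ _ _⟩, ?_, ?_⟩
  · refine ⟨d * (c + 6), ?_⟩
    filter_upwards [hev, hlogN, eventually_ge_atTop 2, hm.eventually hRA, hm.eventually hmlog,
      hm.eventually hmχ, hm.eventually hSC.bound, hm.eventually hTc.bound,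
      hm.eventually hTq.bound] with N hev hlogN hN2 hRA hmlog hmχ hSC hTc hTq
    obtain ⟨hNm, hmd, hlow, hupp, hmA, hlog⟩ := hev
    have hlog0 : 0 ≤ Real.log (m N : ℝ) := Real.log_natCast_nonneg _
    obtain ⟨F, hFS, hFw, hFq, hF⟩ := exists_functionInverter_of_bounds (B := B) (a₁ := a₁)
      (a₂ := a₂) (C₁ := C₁) (C₂ := C₂) hRA (hσ _) hχ0 hδ hC hC₁ hC₂ rfl hB
      ((Real.le_norm_self _).trans (by
        rwa [Real.norm_of_nonneg (by positivity : 0 ≤ (m N : ℝ) ^ χ)] at hSC))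
      ((Real.le_norm_self _).trans (by
        rwa [Real.norm_of_nonneg
          (by positivity : 0 ≤ Real.log (m N : ℝ) ^ a₁ * (m N : ℝ) ^ (χ + δ))] at hTc))
      ((Real.le_norm_self _).trans (by
        rwa [Real.norm_of_nonneg
          (by positivity : 0 ≤ Real.log (m N : ℝ) ^ a₂ * (m N : ℝ) ^ δ)] at hTq))
      hmlog hmχ hN2 hNm hlow hupp hlogN hlog
    have hpoly : m N ^ (c + 6) ≤ N ^ (d * (c + 6)) := by
      rw [pow_mul]; exact Nat.pow_le_pow_left hmd _
    refine ⟨F, hFS.trans ?_, hFw.trans hpoly, hFq.trans hpoly, hF.mono ?_⟩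
    · have := hrpow χ hχ0.le N (m N) hmA
      calc (2 * C + 1) * (2 * c * B + 3) * (Real.log N * (m N : ℝ) ^ χ)
          ≤ (2 * C + 1) * (2 * c * B + 3) *
              (Real.log N * (A ^ χ * (N : ℝ) ^ (χ / (1 - χ)))) := by gcongr
        _ = Cs * (Real.log N ^ 1 * (N : ℝ) ^ (χ / (1 - χ))) := by rw [hCs]; ring
    · have := hrpow (χ + δ) (by linarith) N (m N) hmA
      calc (C₁ + 2 * (C + 3) * C₂ + 2 * C + 2 * (C + 3) + 3) *
            (Real.log (m N) ^ (a₁ + a₂) * (m N : ℝ) ^ (χ + δ))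
          ≤ (C₁ + 2 * (C + 3) * C₂ + 2 * C + 2 * (C + 3) + 3) *
            ((B * Real.log N) ^ (a₁ + a₂) * (A ^ (χ + δ) * (N : ℝ) ^ ((χ + δ) / (1 - χ)))) := by
            gcongr
        _ = Ct * (Real.log N ^ (a₁ + a₂) * (N : ℝ) ^ ((χ + δ) / (1 - χ))) := by
            rw [hCt, mul_pow]; ring
  · filter_upwards [hlogN, eventually_ge_atTop 1] with N hlogN hN
    have hN' : (1 : ℝ) ≤ N := by exact_mod_cast hN
    -- Equivalent to `2 / 5 ≤ χ`.
    have hexp : (2 / 3 : ℝ) ≤ χ / (1 - χ) := by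
      rw [div_le_div_iff₀ (by norm_num) hθ]; linarith
    have hCs1 : 1 ≤ Cs := by
      have h1 : 1 ≤ A ^ χ := Real.one_le_rpow hA hχ0.le
      have h2 : 1 ≤ 2 * C + 1 := by linarith
      have h3 : 0 ≤ 2 * (c : ℝ) * B := by positivity
      exact one_le_mul_of_one_le_of_one_le
        (one_le_mul_of_one_le_of_one_le h2 (by linarith)) h1
    calc (N : ℝ) ^ (2 / 3 : ℝ) ≤ (N : ℝ) ^ (χ / (1 - χ)) :=
          Real.rpow_le_rpow_of_exponent_le hN' hexp
      _ = 1 * (1 * (N : ℝ) ^ (χ / (1 - χ))) := by ring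
      _ ≤ Cs * (Real.log N ^ 1 * (N : ℝ) ^ (χ / (1 - χ))) := by
        rw [pow_one]; gcongr
  · set e := (4 * χ + δ) / (1 - χ) with he
    have he3 : e < 3 := by rw [he, div_lt_iff₀ hθ]; linarith
    -- Half of the gap between `e` and 3 absorbs the logarithms, three from `S³` and `a₁ + a₂` from
    -- `T`; the other half is the gain.
    refine ⟨(3 - e) / 2, by linarith, ?_⟩
    have hlogO : (fun N : ℕ => Real.log N ^ (a₁ + a₂ + 3)) =O[atTop]
        fun N : ℕ => (N : ℝ) ^ ((3 - e) / 2) := by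
      have h := (isLittleO_log_rpow_rpow_atTop ((a₁ + a₂ + 3 : ℕ) : ℝ)
        (by linarith : 0 < (3 - e) / 2)).isBigO.comp_tendsto
        (tendsto_natCast_atTop_atTop (R := ℝ))
      simpa [Function.comp_def, ← Real.rpow_natCast] using h
    have hprod := (hlogO.mul (isBigO_refl (fun N : ℕ => (N : ℝ) ^ e) atTop)).const_mul_left
      (Cs ^ 3 * Ct)
    refine hprod.congr' ?_ ?_
    · filter_upwards [eventually_ge_atTop 1] with N hN
      have hN0 : (0 : ℝ) < N := by exact_mod_cast hN
      have : (N : ℝ) ^ e = ((N : ℝ) ^ (χ / (1 - χ))) ^ 3 * (N : ℝ) ^ ((χ + δ) / (1 - χ)) := by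
        rw [← Real.rpow_natCast, ← Real.rpow_mul hN0.le, ← Real.rpow_add hN0, he]
        congr 1
        push_cast
        ring
      rw [this]
      ring
    · filter_upwards [eventually_ge_atTop 1] with N hN
      have hN0 : (0 : ℝ) < N := by exact_mod_cast hN
      rw [← Real.rpow_add hN0]
      congr 1
      ring
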